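/- Let $\mathbb{N}=\{0,1,2,\dots\}$. A polynomial $P(x,y,z,w)$ with integer coefficients is called suitable if every $n\in\mathbb{N}$ can be written as $n=x^2+y^2+z^2+w^2$ with $x,y,z,w\in\mathbb{N}$ such that $P(x,y,z,w)$ is the square of an integer (possibly $0$). (i) Every $n\in\mathbb{N}$ can be written as $n=x^2+y^2+z^2+w^2$ with $x,y,z,w\in\mathbb{N}$ such that $x^2-y^2$ is an even square. Also, the polynomials $2(x^2-y^2)$, $3(x^2-y^2)$, $x^2-3y^2$ and $3x^2-2y^2$ are all suitable. (ii) All the polynomials $$x^2+2y^2,\ x^2+3y^2,\ x^2+5y^2,\ x^2+6y^2,\ x^2+8y^2,\ x^2+12y^2,\ 2x^2+7y^2,$$ $$3x^2+4y^2,\ 4x^2+5y^2,\ 4x^2+9y^2,\ 5x^2+11y^2,\ 6x^2+10y^2,\ 7x^2+9y^2$$ are suitable. -/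

import Mathlib

/-- A polynomial `P(x, y, z, w)` with integer coefficients is *suitable* if every natural number
`n` is `x² + y² + z² + w²` for some natural numbers `x, y, z, w` such that `P(x, y, z, w)` is the
square of an integer (`0` counts as a square). -/
def Suitable (P : MvPolynomial (Fin 4) ℤ) : Prop :=
  ∀ n : ℕ, ∃ x y z w : ℕ, n = x ^ 2 + y ^ 2 + z ^ 2 + w ^ 2 ∧
    IsSquare (MvPolynomial.eval (![(x : ℤ), (y : ℤ), (z : ℤ), (w : ℤ)] : Fin 4 → ℤ) P)

/-- The variable `x` of the polynomial ring in the four variables `x, y, z, w` over `ℤ`. -/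
noncomputable abbrev polyX : MvPolynomial (Fin 4) ℤ := MvPolynomial.X 0

/-- The variable `y` of the polynomial ring in the four variables `x, y, z, w` over `ℤ`. -/
noncomputable abbrev polyY : MvPolynomial (Fin 4) ℤ := MvPolynomial.X 1

/-!
If `P = A x² + B y²` takes a square value at `(a, b)`, it takes a square value at every `(a t, b t)`,
and then `n = z² + w² + (a² + b²) t²` is a representation of the required kind. So it is enough to
find, for each of the forms, two pairs `(a, b)` such that every `n` is represented by one of the two
ternary forms `z² + w² + m t²` with `m = a² + b²` (`suitable_of_repBy`); `m ∈ {1, 2, 4, 5, 10}`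
suffices. One may assume that `4 ∤ n` (`repBy_or_repBy`).

The representability results (`repBy_one`, `repBy_two`, `repBy_four`, `repBy_five`, `repBy_ten`) all
reduce to the three-square theorem `sum_three_sq`: `n` is represented with `m = 2` when `2 n` is a sum
of three squares, and with `m = 5` when `5 n` is one, because among three squares whose sum is divisible
by `5` one is itself divisible by `5`; the case `m = 10` for even `n` follows from `m = 5` for `n / 2`.

For the three-square theorem, Dirichlet's theorem on primes in arithmetic progressions gives a `q`
(a prime, or twice a prime) that is a sum of two squares, with `q ≡ -1` modulo `n` and, by quadratic
reciprocity, `n` a square modulo `q`. A pigeonhole argument then solves `n u² = w² + q v²`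
(`exists_mul_sq_eq_sq_add_mul_sq`), so that `n` is a sum of three rational squares, and the
Davenport–Cassels descent (`sum_three_sq_of_mul_sq`) makes the squares integral.
-/

/-! ### Descent from rational to integral sums of three squares -/

theorem sq_add_sq_add_sq_eq_zero {x y z : ℤ} (h : x ^ 2 + y ^ 2 + z ^ 2 = 0) :
    x = 0 ∧ y = 0 ∧ z = 0 := by
  have hx := sq_nonneg x
  have hy := sq_nonneg y
  have hz := sq_nonneg z
  exact ⟨pow_eq_zero_iff two_ne_zero |>.1 (by linarith),
    pow_eq_zero_iff two_ne_zero |>.1 (by linarith), pow_eq_zero_iff two_ne_zero |>.1 (by linarith)⟩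

/-- The Davenport–Cassels descent: an integer that is a sum of three squares of rationals is a sum of
three squares of integers. It works because every point of `ℚ³` has squared distance at most
`3 / 4 < 1` from `ℤ³`. -/
theorem sum_three_sq_of_mul_sq (n t : ℕ) (ht : 0 < t) (x y z : ℤ)
    (h : (n : ℤ) * t ^ 2 = x ^ 2 + y ^ 2 + z ^ 2) :
    ∃ a b c : ℤ, (n : ℤ) = a ^ 2 + b ^ 2 + c ^ 2 := by
  induction t using Nat.strong_induction_on generalizing x y z with
  | _ t ih =>
  have round : ∀ x : ℤ, ∃ a : ℤ, 4 * (t * a - x) ^ 2 ≤ (t : ℤ) ^ 2 := by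
    intro x
    refine ⟨(2 * x + t) / (2 * t), ?_⟩
    have h1 := Int.emod_add_mul_ediv (2 * x + t) (2 * t)
    have h2 := Int.emod_nonneg (2 * x + t) (b := 2 * (t : ℤ)) (by positivity)
    have h3 := Int.emod_lt_of_pos (2 * x + t) (b := 2 * (t : ℤ)) (by positivity)
    have h4 : |2 * (t * ((2 * x + t) / (2 * t)) - x)| ≤ (t : ℤ) := by
      rw [abs_le]; constructor <;> linarith
    have := sq_le_sq' (abs_le.1 h4).1 (abs_le.1 h4).2
    linarith
  obtain ⟨a, ha⟩ := round x
  obtain ⟨b, hb⟩ := round y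
  obtain ⟨c, hc⟩ := round z
  have ht' : (0 : ℤ) < t := by exact_mod_cast ht
  -- The line through `(x, y, z) / t` and the lattice point `(a, b, c)` meets the sphere again in
  -- a point with denominator `s`.
  set A : ℤ := a ^ 2 + b ^ 2 + c ^ 2 - n with hA
  set B : ℤ := 2 * (n * t - (x * a + y * b + z * c)) with hB
  set s : ℤ := A * t + B with hs
  have key : t * s = (t * a - x) ^ 2 + (t * b - y) ^ 2 + (t * c - z) ^ 2 := by
    rw [hs, hA, hB]; linear_combination h
  have key2 : (n : ℤ) * s ^ 2 =
      (A * x + B * a) ^ 2 + (A * y + B * b) ^ 2 + (A * z + B * c) ^ 2 := by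
    rw [hs, hA, hB]
    linear_combination (a ^ 2 + b ^ 2 + c ^ 2 - n : ℤ) ^ 2 * h
  have hs0 : 0 ≤ s := by
    have : 0 ≤ t * s := by rw [key]; positivity
    exact nonneg_of_mul_nonneg_right this ht'
  rcases hs0.eq_or_lt with h0 | hpos
  · have h0' : (t * a - x) ^ 2 + (t * b - y) ^ 2 + (t * c - z) ^ 2 = 0 := by
      rw [← key, ← h0, mul_zero]
    obtain ⟨hx, hy, hz⟩ := sq_add_sq_add_sq_eq_zero h0'
    refine ⟨a, b, c, ?_⟩
    have : (t : ℤ) ^ 2 * n = t ^ 2 * (a ^ 2 + b ^ 2 + c ^ 2) := by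
      rw [mul_comm, h, ← sub_eq_zero.1 hx, ← sub_eq_zero.1 hy, ← sub_eq_zero.1 hz]; ring
    exact mul_left_cancel₀ (by positivity) this
  · have hlt : s < t := by
      by_contra! hge
      nlinarith
    have hcast : ((s.toNat : ℕ) : ℤ) = s := Int.toNat_of_nonneg hs0
    exact ih s.toNat (by omega) (by omega) _ _ _ (by rw [hcast]; exact key2)

/-! ### A case of Legendre's theorem on ternary quadratic equations -/

/-- The pigeonhole principle, applied to the box `0 ≤ w ≤ √(n q)`, `0 ≤ v ≤ √n`, `0 ≤ u ≤ √q`, which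
has more than `n q` lattice points, and the residues of `w - r u` modulo `q` and `w - v` modulo `n`. -/
theorem exists_small_solution {n q : ℕ} (hn : 0 < n) (hq : 0 < q) (r : ℤ) :
    ∃ w v u : ℤ, ¬ (w = 0 ∧ v = 0 ∧ u = 0) ∧ (q : ℤ) ∣ w - r * u ∧ (n : ℤ) ∣ w - v ∧
      w ^ 2 ≤ n * q ∧ v ^ 2 ≤ n ∧ u ^ 2 ≤ q := by
  have : NeZero n := ⟨hn.ne'⟩
  have : NeZero q := ⟨hq.ne'⟩
  set A := Nat.sqrt (n * q) with hA
  set B := Nat.sqrt n with hB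
  set C := Nat.sqrt q with hC
  let S := Finset.range (A + 1) ×ˢ (Finset.range (B + 1) ×ˢ Finset.range (C + 1))
  let f : ℕ × ℕ × ℕ → ZMod q × ZMod n := fun p =>
    (((p.1 - r * p.2.2 : ℤ) : ZMod q), ((p.1 - p.2.1 : ℤ) : ZMod n))
  have hcard : (Finset.univ : Finset (ZMod q × ZMod n)).card < S.card := by
    simp only [S, Finset.card_univ, Fintype.card_prod, ZMod.card, Finset.card_product,
      Finset.card_range]
    have h1 : n * q < (A + 1) ^ 2 := Nat.lt_succ_sqrt' _
    have h2 : n < (B + 1) ^ 2 := Nat.lt_succ_sqrt' _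
    have h3 : q < (C + 1) ^ 2 := Nat.lt_succ_sqrt' _
    refine lt_of_pow_lt_pow_left₀ 2 (Nat.zero_le _) ?_
    calc (q * n) ^ 2 = (n * q) * (n * q) := by ring
      _ < (A + 1) ^ 2 * ((B + 1) ^ 2 * (C + 1) ^ 2) := by gcongr
      _ = _ := by ring
  obtain ⟨p, hp, p', hp', hne, hf⟩ :=
    Finset.exists_ne_map_eq_of_card_lt_of_maps_to hcard (f := f) (fun _ _ => Finset.mem_univ _)
  have bound : ∀ i j m : ℕ, i < Nat.sqrt m + 1 → j < Nat.sqrt m + 1 →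
      ((i : ℤ) - j) ^ 2 ≤ m := by
    intro i j m hi hj
    have h1 : |(i : ℤ) - j| ≤ Nat.sqrt m := by rw [abs_le]; constructor <;> omega
    have h2 : ((Nat.sqrt m : ℕ) : ℤ) ^ 2 ≤ m := by exact_mod_cast Nat.sqrt_le' m
    exact (sq_le_sq' (abs_le.1 h1).1 (abs_le.1 h1).2).trans h2
  obtain ⟨w, v, u⟩ := p
  obtain ⟨w', v', u'⟩ := p'
  simp only [S, Finset.mem_product, Finset.mem_range] at hp hp'
  simp only [f, Prod.mk.injEq, ZMod.intCast_eq_intCast_iff_dvd_sub] at hf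
  refine ⟨w' - w, v' - v, u' - u, ?_, ?_, ?_, ?_, bound _ _ _ hp'.2.1 hp.2.1,
    bound _ _ _ hp'.2.2 hp.2.2⟩
  · rintro ⟨h1, h2, h3⟩
    apply hne
    simp only [Prod.mk.injEq]
    omega
  · convert hf.1 using 1; ring
  · convert hf.2 using 1; ring
  · exact_mod_cast bound _ _ _ hp'.1 hp.1

/-- A case of Legendre's theorem: `n u² = w² + q v²` is solvable when `n` is a square modulo `q` and
`-q ≡ 1` modulo `n`. For the small vector of `exists_small_solution`, `w² + q v² - n u²` is a multiple
of `n q` strictly between `-n q` and `2 n q`, so it is `0` or `n q`. -/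
theorem exists_mul_sq_eq_sq_add_mul_sq {n q : ℕ} (hn : 0 < n) (hq : ¬ IsSquare q)
    (hnq : n ∣ q + 1) {r : ℤ} (hr : (q : ℤ) ∣ r ^ 2 - n) :
    ∃ u w v : ℤ, u ≠ 0 ∧ (n : ℤ) * u ^ 2 = w ^ 2 + q * v ^ 2 := by
  have hq0 : 0 < q := Nat.pos_of_ne_zero (by rintro rfl; exact hq (IsSquare.zero))
  have hn' : (0 : ℤ) < n := by exact_mod_cast hn
  have hq' : (0 : ℤ) < q := by exact_mod_cast hq0
  obtain ⟨w, v, u, h0, hwu, hwv, hw, hv, hu⟩ := exists_small_solution hn hq0 r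
  have hcop : IsCoprime (n : ℤ) q := by
    obtain ⟨k, hk⟩ := hnq
    refine ⟨k, -1, ?_⟩
    have : (q : ℤ) + 1 = n * k := by exact_mod_cast hk
    linear_combination -this
  have hdq : (q : ℤ) ∣ w ^ 2 + q * v ^ 2 - n * u ^ 2 := by
    have : w ^ 2 + q * v ^ 2 - n * u ^ 2 =
        (w - r * u) * (w + r * u) + (r ^ 2 - n) * u ^ 2 + q * v ^ 2 := by ring
    rw [this]
    exact dvd_add (dvd_add (hwu.mul_right _) (hr.mul_right _)) (dvd_mul_right _ _)
  have hdn : (n : ℤ) ∣ w ^ 2 + q * v ^ 2 - n * u ^ 2 := by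
    have : w ^ 2 + q * v ^ 2 - n * u ^ 2 =
        (w - v) * (w + v) + (q + 1) * v ^ 2 - n * u ^ 2 := by ring
    rw [this]
    have hnq' : (n : ℤ) ∣ q + 1 := by exact_mod_cast hnq
    exact dvd_sub (dvd_add (hwv.mul_right _) (hnq'.mul_right _)) (dvd_mul_right _ _)
  obtain ⟨k, hk⟩ := hcop.mul_dvd hdn hdq
  have hu' : u ^ 2 < q := by
    refine lt_of_le_of_ne hu fun h => hq ⟨u.natAbs, ?_⟩
    zify; rw [abs_mul_abs_self, ← h, sq]
  have hnu : (n : ℤ) * u ^ 2 < n * q := by gcongr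
  have hqv : (q : ℤ) * v ^ 2 ≤ n * q := by nlinarith
  have hk1 : -1 < k := by
    have : (n * q : ℤ) * (-1) < n * q * k := by rw [← hk]; nlinarith [sq_nonneg w, sq_nonneg v]
    exact lt_of_mul_lt_mul_left this (by positivity)
  have hlt : w ^ 2 + q * v ^ 2 - n * u ^ 2 < 2 * (n * q) := by
    by_contra! hge
    -- In the extreme case both `n * q` and `n` are squares, and then so is `q`.
    have h1 : w ^ 2 = n * q := by nlinarith [sq_nonneg u]
    have h2 : (q : ℤ) * v ^ 2 = q * n := by nlinarith [sq_nonneg u]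
    have h3 : v ^ 2 = n := mul_left_cancel₀ hq'.ne' h2
    have hv0 : v ≠ 0 := by rintro rfl; simp at h3; omega
    have h4 : v ∣ w := (Int.pow_dvd_pow_iff two_ne_zero).1 ⟨q, by rw [h1, h3]⟩
    obtain ⟨e, rfl⟩ := h4
    refine hq ⟨e.natAbs, ?_⟩
    zify
    rw [abs_mul_abs_self]
    refine mul_left_cancel₀ (pow_ne_zero 2 hv0) ?_
    rw [h3, ← h1, mul_pow, h3, sq e]
  have hk2 : k < 2 := by
    have : (n * q : ℤ) * k < n * q * 2 := by rw [← hk]; linarith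
    exact lt_of_mul_lt_mul_left this (by positivity)
  obtain rfl | rfl : k = 0 ∨ k = 1 := by omega
  · refine ⟨u, w, v, ?_, by linarith⟩
    rintro rfl
    have h1 : w ^ 2 + q * v ^ 2 = 0 := by linarith
    have h2 : w = 0 := by nlinarith [sq_nonneg v, sq_nonneg w]
    subst h2
    have h3 : v = 0 := by
      have : (q : ℤ) * v ^ 2 = 0 := by linarith
      simpa [hq0.ne'] using this
    exact h0 ⟨rfl, h3, rfl⟩
  · -- Compose `w² + q v² = n (u² + q)` with the norm `u² + q`.
    refine ⟨u ^ 2 + q, w * u + q * v, w - u * v, by positivity, ?_⟩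
    linear_combination (-(u ^ 2 + q : ℤ)) * hk

/-! ### The three-square theorem -/

/-- If moreover `q` is a sum of two squares, then `n u² = w² + q v²` exhibits `n` as a sum of three
rational squares. -/
theorem sum_three_sq_of_sq_add_sq {n q : ℕ} (hn : 0 < n) (hq : ¬ IsSquare q)
    (hnq : n ∣ q + 1) {r : ℤ} (hr : (q : ℤ) ∣ r ^ 2 - n) {a b : ℤ} (hab : a ^ 2 + b ^ 2 = q) :
    ∃ x y z : ℤ, (n : ℤ) = x ^ 2 + y ^ 2 + z ^ 2 := by
  obtain ⟨u, w, v, hu, h⟩ := exists_mul_sq_eq_sq_add_mul_sq hn hq hnq hr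
  refine sum_three_sq_of_mul_sq n u.natAbs (by omega) w (a * v) (b * v) ?_
  rw [Int.natCast_natAbs, sq_abs, h, ← hab]
  ring

/-- Dirichlet's theorem for a class modulo an odd `m` together with an odd class modulo `8`. -/
theorem exists_prime_dvd_sub_mod_eight {m : ℕ} {a : ℤ} (hm : Odd m) (ha : IsCoprime a m) {c : ℕ}
    (hc : Odd c) : ∃ p : ℕ, p.Prime ∧ (m : ℤ) ∣ p - a ∧ p % 8 = c % 8 := by
  have hm0 : m ≠ 0 := hm.pos.ne'
  have h2m : IsCoprime (m : ℤ) 2 := by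
    obtain ⟨k, hk⟩ := hm
    exact ⟨1, -k, by rw [hk]; push_cast; ring⟩
  have h2c : IsCoprime (c : ℤ) 2 := by
    obtain ⟨k, hk⟩ := hc
    exact ⟨1, -k, by rw [hk]; push_cast; ring⟩
  have h8m : IsCoprime (m : ℤ) 8 := by simpa using h2m.pow_right (n := 3)
  have h8c : IsCoprime (c : ℤ) 8 := by simpa using h2c.pow_right (n := 3)
  obtain ⟨i, j, hij⟩ := h8m
  -- The Chinese remainder theorem: this residue is `a` modulo `m` and `c` modulo `8`.
  have e1 : c * (i * m) + a * (j * 8) = a + m * (i * (c - a)) := by linear_combination a * hij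
  have e2 : c * (i * m) + a * (j * 8) = c + 8 * (j * (a - c)) := by linear_combination c * hij
  have h1 : IsCoprime (c * (i * m) + a * (j * 8)) (m : ℤ) := by
    rw [e1]; exact ha.add_mul_left_left _
  have h2 : IsCoprime (c * (i * m) + a * (j * 8)) (8 : ℤ) := by
    rw [e2]; exact h8c.add_mul_left_left _
  obtain ⟨p, -, hp, h⟩ := Nat.forall_exists_prime_gt_and_zmodEq 0 (q := m * 8)
    (a := c * (i * m) + a * (j * 8)) (by omega) (by push_cast; exact h1.mul_right h2)
  have hd : ((m * 8 : ℕ) : ℤ) ∣ p - (c * (i * m) + a * (j * 8)) := h.symm.dvd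
  push_cast at hd
  refine ⟨p, hp, ?_, ?_⟩
  · rw [e1] at hd
    rw [show (p : ℤ) - a = (p - (a + m * (i * (c - a)))) + m * (i * (c - a)) by ring]
    exact dvd_add (dvd_of_mul_right_dvd hd) (dvd_mul_right _ _)
  · rw [e2] at hd
    have := dvd_of_mul_left_dvd hd
    omega

open scoped NumberTheorySymbols in
theorem exists_dvd_sq_sub_of_jacobiSym {p : ℕ} (hp : p.Prime) {a : ℤ} (h : J(a | p) = 1) :
    ∃ r : ℤ, (p : ℤ) ∣ r ^ 2 - a := by
  have : Fact p.Prime := ⟨hp⟩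
  obtain ⟨s, hs⟩ := ZMod.isSquare_of_jacobiSym_eq_one h
  obtain ⟨r, rfl⟩ := ZMod.intCast_surjective s
  refine ⟨r, ?_⟩
  rw [← ZMod.intCast_eq_intCast_iff_dvd_sub, hs]
  push_cast
  ring

theorem exists_sq_add_sq_of_prime {p : ℕ} (hp : p.Prime) (h : p % 4 = 1) :
    ∃ a b : ℤ, a ^ 2 + b ^ 2 = p := by
  have : Fact p.Prime := ⟨hp⟩
  obtain ⟨a, b, hab⟩ := Nat.Prime.sq_add_sq (p := p) (by omega)
  exact ⟨a, b, by exact_mod_cast hab⟩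

open scoped NumberTheorySymbols in
theorem jacobiSym_eq_of_dvd_sub {a b : ℤ} {n : ℕ} (h : (n : ℤ) ∣ a - b) : J(a | n) = J(b | n) :=
  jacobiSym.mod_left' (Int.emod_eq_emod_iff_emod_sub_eq_zero.2 (Int.emod_eq_zero_of_dvd h))

open scoped NumberTheorySymbols in
/-- Here `q` is a prime with `q ≡ -1` modulo `n` and `q ≡ 1` modulo `8`. -/
theorem sum_three_sq_of_mod_four_eq_one {n : ℕ} (h : n % 4 = 1) :
    ∃ x y z : ℤ, (n : ℤ) = x ^ 2 + y ^ 2 + z ^ 2 := by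
  have hodd : Odd n := Nat.odd_iff.2 (by omega)
  obtain ⟨p, hp, h1, h2⟩ := exists_prime_dvd_sub_mod_eight hodd (a := -1) (c := 1)
    isCoprime_one_left.neg_left odd_one
  have hJ : J(n | p) = 1 := by
    rw [jacobiSym.quadratic_reciprocity_one_mod_four h (Nat.odd_iff.2 (by omega)),
      jacobiSym_eq_of_dvd_sub h1, jacobiSym.at_neg_one hodd, ZMod.χ₄_nat_one_mod_four h]
  obtain ⟨r, hr⟩ := exists_dvd_sq_sub_of_jacobiSym hp hJ
  obtain ⟨a, b, hab⟩ := exists_sq_add_sq_of_prime hp (by omega)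
  exact sum_three_sq_of_sq_add_sq hodd.pos hp.prime.not_isSquare
    (by zify; simpa using h1) hr hab

open scoped NumberTheorySymbols in
/-- Here `q` is twice a prime, with `q ≡ -1` modulo `n`. -/
theorem sum_three_sq_of_mod_eight_eq_three {n : ℕ} (h : n % 8 = 3) :
    ∃ x y z : ℤ, (n : ℤ) = x ^ 2 + y ^ 2 + z ^ 2 := by
  have hodd : Odd n := Nat.odd_iff.2 (by omega)
  -- With `p ≡ (n - 1) / 2` modulo `n` one has `2 p ≡ -1`.
  obtain ⟨k, hk⟩ := hodd
  have hodd : Odd n := ⟨k, hk⟩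
  obtain ⟨p, hp, h1, h2⟩ := exists_prime_dvd_sub_mod_eight hodd (a := k) (c := 1)
    ⟨-2, 1, by rw [hk]; push_cast; ring⟩ odd_one
  have h1' : (n : ℤ) ∣ 2 * p + 1 := by
    rw [show (2 * p + 1 : ℤ) = 2 * (p - k) + n by rw [hk]; push_cast; ring]
    exact dvd_add (h1.mul_left 2) dvd_rfl
  have hJ : J(n | p) = 1 := by
    rw [jacobiSym.quadratic_reciprocity_one_mod_four' hodd (by omega)]
    have e1 : J(-2 * p | n) = 1 := by
      rw [jacobiSym_eq_of_dvd_sub (b := 1) (by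
          rw [← dvd_neg, show -(-2 * p - 1 : ℤ) = 2 * p + 1 by ring]; exact h1'),
        jacobiSym.one_left]
    have e2 : J(-2 | n) = 1 := by
      rw [jacobiSym.at_neg_two hodd, ZMod.χ₈'_nat_eq_if_mod_eight]
      simp [h, Nat.odd_iff.1 hodd]
    rwa [jacobiSym.mul_left, e2, one_mul] at e1
  obtain ⟨r, hr⟩ := exists_dvd_sq_sub_of_jacobiSym hp hJ
  -- Replace the root `r` modulo `p` by an odd one, so that it is a root modulo `2 p`.
  obtain ⟨s, hs, hs2⟩ : ∃ s : ℤ, (p : ℤ) ∣ s ^ 2 - n ∧ Odd s := by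
    rcases Int.even_or_odd r with he | ho
    · refine ⟨r + p, ?_, he.add_odd (by exact_mod_cast Nat.odd_iff.2 (by omega))⟩
      rw [show (r + p) ^ 2 - n = (r ^ 2 - n) + p * (2 * r + p) by ring]
      exact dvd_add hr (dvd_mul_right _ _)
    · exact ⟨r, hr, ho⟩
  have h2s : (2 : ℤ) ∣ s ^ 2 - n :=
    (hs2.pow.sub_odd (by exact_mod_cast hodd)).two_dvd
  have h2p : IsCoprime (2 : ℤ) p :=
    ⟨-(p / 2 : ℕ), 1, by have : p = 2 * (p / 2) + 1 := by omega
                         zify at this; push_cast; linarith⟩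
  obtain ⟨a, b, hab⟩ := exists_sq_add_sq_of_prime hp (by omega)
  refine sum_three_sq_of_sq_add_sq (q := 2 * p) hodd.pos ?_ (by zify; exact h1')
    (by push_cast; exact h2p.mul_dvd h2s hs) (a := a + b) (b := a - b)
    (by push_cast; linear_combination 2 * hab)
  rintro ⟨c, hc⟩
  have : c * c % 4 = 0 ∨ c * c % 4 = 1 := by
    rcases Nat.even_or_odd' c with ⟨d, rfl | rfl⟩ <;> ring_nf <;> omega
  omega

open scoped NumberTheorySymbols in
/-- Here `q` is a prime with `q ≡ -1` modulo `n` and `q ≡ 1` modulo `4`. -/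
theorem sum_three_sq_of_mod_four_eq_two {n : ℕ} (h : n % 4 = 2) :
    ∃ x y z : ℤ, (n : ℤ) = x ^ 2 + y ^ 2 + z ^ 2 := by
  obtain ⟨m, rfl⟩ : ∃ m, n = 2 * m := ⟨n / 2, by omega⟩
  have hodd : Odd m := Nat.odd_iff.2 (by omega)
  -- The class of `p` modulo `8` is chosen so that `J(2 | p) = J(-1 | m)`.
  obtain ⟨p, hp, h1, h2, hJ⟩ : ∃ p : ℕ, p.Prime ∧ (m : ℤ) ∣ p - (-1) ∧ p % 4 = 1 ∧
      J(2 | p) * J(-1 | m) = 1 := by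
    rcases (by omega : m % 4 = 1 ∨ m % 4 = 3) with hm | hm
    · obtain ⟨p, hp, h1, h2⟩ := exists_prime_dvd_sub_mod_eight hodd (a := -1) (c := 1)
        isCoprime_one_left.neg_left odd_one
      refine ⟨p, hp, h1, by omega, ?_⟩
      rw [jacobiSym.at_neg_one hodd, ZMod.χ₄_nat_one_mod_four hm,
        jacobiSym.at_two (Nat.odd_iff.2 (by omega)), ZMod.χ₈_nat_eq_if_mod_eight]
      simp [h2, (by omega : p % 2 = 1)]
    · obtain ⟨p, hp, h1, h2⟩ := exists_prime_dvd_sub_mod_eight hodd (a := -1) (c := 5)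
        isCoprime_one_left.neg_left (by decide)
      refine ⟨p, hp, h1, by omega, ?_⟩
      rw [jacobiSym.at_neg_one hodd, ZMod.χ₄_nat_three_mod_four hm,
        jacobiSym.at_two (Nat.odd_iff.2 (by omega)), ZMod.χ₈_nat_eq_if_mod_eight]
      simp [h2, (by omega : p % 2 = 1)]
  have hJ' : J((2 * m : ℕ) | p) = 1 := by
    push_cast
    rw [jacobiSym.mul_left, jacobiSym.quadratic_reciprocity_one_mod_four' hodd h2,
      jacobiSym_eq_of_dvd_sub h1, hJ]
  obtain ⟨r, hr⟩ := exists_dvd_sq_sub_of_jacobiSym hp hJ'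
  obtain ⟨a, b, hab⟩ := exists_sq_add_sq_of_prime hp h2
  refine sum_three_sq_of_sq_add_sq (by omega) hp.prime.not_isSquare ?_ hr hab
  refine Nat.Coprime.mul_dvd_of_dvd_of_dvd (Nat.coprime_two_left.2 hodd) (by omega) ?_
  zify
  simpa using h1

/-- The three-square theorem of Legendre and Gauss, for numbers not divisible by `4`. -/
theorem sum_three_sq {n : ℕ} (h4 : n % 4 ≠ 0) (h8 : n % 8 ≠ 7) :
    ∃ x y z : ℤ, (n : ℤ) = x ^ 2 + y ^ 2 + z ^ 2 := by
  rcases (by omega : n % 4 = 1 ∨ n % 8 = 3 ∨ n % 4 = 2) with h | h | h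
  · exact sum_three_sq_of_mod_four_eq_one h
  · exact sum_three_sq_of_mod_eight_eq_three h
  · exact sum_three_sq_of_mod_four_eq_two h

/-! ### The forms `x² + y² + m z²` -/

/-- `n` is represented by the ternary form `x² + y² + m z²` over the integers. -/
def RepBy (m n : ℕ) : Prop :=
  ∃ t z w : ℤ, (n : ℤ) = m * t ^ 2 + z ^ 2 + w ^ 2

theorem RepBy.four_pow_mul {m n : ℕ} (h : RepBy m n) (k : ℕ) : RepBy m (4 ^ k * n) := by
  obtain ⟨t, z, w, h⟩ := h
  refine ⟨2 ^ k * t, 2 ^ k * z, 2 ^ k * w, ?_⟩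
  push_cast
  rw [show (4 : ℤ) = 2 ^ 2 by norm_num, ← pow_mul, mul_comm 2 k, pow_mul, h]
  ring

theorem repBy_one {n : ℕ} (h4 : n % 4 ≠ 0) (h8 : n % 8 ≠ 7) : RepBy 1 n := by
  obtain ⟨x, y, z, h⟩ := sum_three_sq h4 h8
  exact ⟨x, y, z, by rw [h]; push_cast; ring⟩

theorem exists_add_sub_of_even {x y : ℤ} (h : Even (x + y)) :
    ∃ u v : ℤ, x = u + v ∧ y = u - v := by
  obtain ⟨u, hu⟩ := h
  exact ⟨u, x - u, by ring, by linarith⟩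

theorem exists_even_of_sum_three_sq {n x y z : ℤ} (hn : Even n) (h : n = x ^ 2 + y ^ 2 + z ^ 2) :
    ∃ a b c : ℤ, n = a ^ 2 + b ^ 2 + (2 * c) ^ 2 ∧ Even (a + b) := by
  have hp : Even x ∨ Even y ∨ Even z := by
    by_contra! hc
    simp only [Int.not_even_iff_odd] at hc
    rw [h, ← Int.not_odd_iff_even] at hn
    exact hn ((hc.1.pow.add_odd hc.2.1.pow).add_odd hc.2.2.pow)
  have key : ∀ a b c : ℤ, n = a ^ 2 + b ^ 2 + c ^ 2 → Even c →
      ∃ a b c : ℤ, n = a ^ 2 + b ^ 2 + (2 * c) ^ 2 ∧ Even (a + b) := by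
    rintro a b c habc hc
    obtain ⟨d, rfl⟩ := hc.two_dvd
    refine ⟨a, b, d, habc, ?_⟩
    rw [habc] at hn
    simpa [Int.even_add, Int.even_pow] using hn
  rcases hp with hx | hy | hz
  · exact key y z x (by rw [h]; ring) hx
  · exact key x z y (by rw [h]; ring) hy
  · exact key x y z h hz

/-- Twice the form `x² + y² + 2 z²` is `(x + y)² + (x - y)² + (2 z)²`. -/
theorem repBy_two {n : ℕ} (h4 : n % 4 ≠ 0) (h16 : n % 16 ≠ 14) : RepBy 2 n := by
  have h : RepBy 1 (2 * n) := by
    by_cases hn : n % 2 = 1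
    · exact repBy_one (by omega) (by omega)
    · have := (repBy_one (n := n / 2) (by omega) (by omega)).four_pow_mul 1
      rwa [show 4 ^ 1 * (n / 2) = 2 * n by omega] at this
  obtain ⟨x, y, z, h⟩ := h
  obtain ⟨a, b, c, h, hab⟩ := exists_even_of_sum_three_sq (n := (2 * n : ℕ)) (x := x) (y := y)
    (z := z) (by push_cast; exact even_two_mul _) (by rw [h]; push_cast; ring)
  obtain ⟨u, v, rfl, rfl⟩ := exists_add_sub_of_even hab
  refine ⟨c, u, v, ?_⟩
  push_cast at h ⊢
  linarith

theorem repBy_four {n : ℕ} (h : n % 4 = 2) : RepBy 4 n := by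
  obtain ⟨x, y, z, hxyz⟩ := sum_three_sq (n := n) (by omega) (by omega)
  obtain ⟨a, b, c, h, -⟩ := exists_even_of_sum_three_sq (n := n)
    (by exact_mod_cast Nat.even_iff.2 (by omega)) hxyz
  exact ⟨c, a, b, by rw [h]; push_cast; ring⟩

/-- Five times the form `x² + y² + 5 z²` is `(x + 2 y)² + (2 x - y)² + (5 z)²`. Conversely, if a
multiple of `5` is a sum of three squares, then one of these is divisible by `5`, and for a suitable
choice of signs the other two come from such a pair of linear forms. -/
theorem repBy_five {n : ℕ} (h4 : n % 4 ≠ 0) (h8 : n % 8 ≠ 3) : RepBy 5 n := by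
  have key' : ∀ x y z : ℤ, ((5 * n : ℕ) : ℤ) = x ^ 2 + y ^ 2 + z ^ 2 → 5 ∣ z → 5 ∣ x + 2 * y →
      RepBy 5 n := by
    rintro x y z h ⟨t, rfl⟩ ⟨u, hu⟩
    obtain rfl : x = 5 * u - 2 * y := by linarith
    refine ⟨t, u, 2 * u - y, ?_⟩
    push_cast at h ⊢
    linarith
  have key : ∀ x y z : ℤ, ((5 * n : ℕ) : ℤ) = x ^ 2 + y ^ 2 + z ^ 2 → 5 ∣ z → RepBy 5 n := by
    intro x y z h hz
    have hxy : (5 : ℤ) ∣ (x + 2 * y) * (x + 2 * -y) := by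
      obtain ⟨t, rfl⟩ := hz
      refine ⟨n - y ^ 2 - 5 * t ^ 2, ?_⟩
      push_cast at h
      linear_combination -h
    have h5 : Prime (5 : ℤ) := Int.prime_iff_natAbs_prime.2 (by norm_num)
    rcases h5.dvd_or_dvd hxy with h' | h'
    · exact key' x y z h hz h'
    · exact key' x (-y) z (by rw [h]; ring) hz h'
  obtain ⟨x, y, z, h⟩ := sum_three_sq (n := 5 * n) (by omega) (by omega)
  have sq_mod : ∀ x : ℤ, 5 ∣ x ∨ x ^ 2 % 5 = 1 ∨ x ^ 2 % 5 = 4 := by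
    intro x
    rcases (by omega : x % 5 = 0 ∨ x % 5 = 1 ∨ x % 5 = 2 ∨ x % 5 = 3 ∨ x % 5 = 4) with
      h | h | h | h | h <;> simp [sq, Int.mul_emod, h, Int.dvd_iff_emod_eq_zero]
  rcases sq_mod x with hx | hx
  · exact key y z x (by rw [h]; ring) hx
  rcases sq_mod y with hy | hy
  · exact key x z y (by rw [h]; ring) hy
  rcases sq_mod z with hz | hz
  · exact key x y z h hz
  push_cast at h
  omega

theorem RepBy.two_mul {m n : ℕ} (h : RepBy m n) : RepBy (2 * m) (2 * n) := by
  obtain ⟨t, z, w, h⟩ := h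
  refine ⟨t, z + w, z - w, ?_⟩
  push_cast
  rw [h]
  ring

theorem repBy_ten {n : ℕ} (h : n % 16 = 14) : RepBy 10 n := by
  have := (repBy_five (n := n / 2) (by omega) (by omega)).two_mul
  rwa [show 2 * (n / 2) = n by omega] at this

/-- Since representability passes from `n` to `4 n`, only the `n` not divisible by `4` matter. -/
theorem repBy_or_repBy {a b : ℕ} (h : ∀ n : ℕ, n % 4 ≠ 0 → RepBy a n ∨ RepBy b n) (n : ℕ) :
    RepBy a n ∨ RepBy b n := by
  rcases eq_or_ne n 0 with rfl | hn
  · exact Or.inl ⟨0, 0, 0, by simp⟩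
  · obtain ⟨k, u, hu, rfl⟩ := Nat.exists_eq_pow_mul_and_not_dvd hn 4 (by norm_num)
    exact (h u (by omega)).imp (·.four_pow_mul k) (·.four_pow_mul k)

theorem repBy_one_or_two : ∀ n, RepBy 1 n ∨ RepBy 2 n := repBy_or_repBy fun n h4 => by
  by_cases h : n % 8 = 7
  · exact Or.inr (repBy_two h4 (by omega))
  · exact Or.inl (repBy_one h4 h)

theorem repBy_one_or_five : ∀ n, RepBy 1 n ∨ RepBy 5 n := repBy_or_repBy fun n h4 => by
  by_cases h : n % 8 = 7
  · exact Or.inr (repBy_five h4 (by omega))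
  · exact Or.inl (repBy_one h4 h)

theorem repBy_two_or_four : ∀ n, RepBy 2 n ∨ RepBy 4 n := repBy_or_repBy fun n h4 => by
  by_cases h : n % 16 = 14
  · exact Or.inr (repBy_four (by omega))
  · exact Or.inl (repBy_two h4 h)

theorem repBy_two_or_five : ∀ n, RepBy 2 n ∨ RepBy 5 n := repBy_or_repBy fun n h4 => by
  by_cases h : n % 16 = 14
  · exact Or.inr (repBy_five h4 (by omega))
  · exact Or.inl (repBy_two h4 h)

theorem repBy_two_or_ten : ∀ n, RepBy 2 n ∨ RepBy 10 n := repBy_or_repBy fun n h4 => by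
  by_cases h : n % 16 = 14
  · exact Or.inr (repBy_ten h)
  · exact Or.inl (repBy_two h4 h)

/-! ### Suitable binary quadratic forms -/

theorem RepBy.exists_nat {a b n : ℕ} (h : RepBy (a ^ 2 + b ^ 2) n) :
    ∃ t z w : ℕ, n = (a * t) ^ 2 + (b * t) ^ 2 + z ^ 2 + w ^ 2 := by
  obtain ⟨t, z, w, h⟩ := h
  refine ⟨t.natAbs, z.natAbs, w.natAbs, ?_⟩
  zify
  simp only [mul_pow, sq_abs, h]
  push_cast
  ring

/-- If `A a² + B b²` and `A a'² + B b'²` are squares, then so are the values of `A x² + B y²` at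
`(a t, b t)` and `(a' t, b' t)` for every `t`. Hence it suffices that every `n` is represented by
one of the forms `z² + w² + (a² + b²) t²` and `z² + w² + (a'² + b'²) t²`. -/
theorem suitable_of_repBy {P : MvPolynomial (Fin 4) ℤ} {A B : ℤ}
    (hP : ∀ f : Fin 4 → ℤ, MvPolynomial.eval f P = A * f 0 ^ 2 + B * f 1 ^ 2)
    (a b a' b' : ℕ) (h : IsSquare (A * a ^ 2 + B * b ^ 2))
    (h' : IsSquare (A * a' ^ 2 + B * b' ^ 2))
    (hrep : ∀ n, RepBy (a ^ 2 + b ^ 2) n ∨ RepBy (a' ^ 2 + b' ^ 2) n) : Suitable P := by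
  have key : ∀ a b n : ℕ, IsSquare (A * a ^ 2 + B * b ^ 2) → RepBy (a ^ 2 + b ^ 2) n →
      ∃ x y z w : ℕ, n = x ^ 2 + y ^ 2 + z ^ 2 + w ^ 2 ∧
        IsSquare (MvPolynomial.eval (![(x : ℤ), (y : ℤ), (z : ℤ), (w : ℤ)] : Fin 4 → ℤ) P) := by
    rintro a b n ⟨c, hc⟩ hr
    obtain ⟨t, z, w, hn⟩ := hr.exists_nat
    refine ⟨a * t, b * t, z, w, hn, c * t, ?_⟩
    rw [hP]
    simp only [Matrix.cons_val_zero, Matrix.cons_val_one]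
    push_cast
    linear_combination (t : ℤ) ^ 2 * hc
  intro n
  exact (hrep n).elim (key a b n h) (key a' b' n h')

/-- Either `x = y`, or `y = 0` and `x = 2 t` is even. -/
theorem exists_sq_sub_sq_even_square (n : ℕ) : ∃ x y z w : ℕ, n = x ^ 2 + y ^ 2 + z ^ 2 + w ^ 2 ∧
    IsSquare ((x : ℤ) ^ 2 - (y : ℤ) ^ 2) ∧ Even ((x : ℤ) ^ 2 - (y : ℤ) ^ 2) := by
  rcases repBy_two_or_four n with h | h
  · obtain ⟨t, z, w, h⟩ := RepBy.exists_nat (a := 1) (b := 1) h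
    exact ⟨1 * t, 1 * t, z, w, h, by simp, by simp⟩
  · obtain ⟨t, z, w, h⟩ := RepBy.exists_nat (a := 2) (b := 0) h
    refine ⟨2 * t, 0 * t, z, w, h, ⟨2 * t, ?_⟩, ⟨2 * t ^ 2, ?_⟩⟩ <;> push_cast <;> ring

theorem theorem1p5 :
    ((∀ n : ℕ, ∃ x y z w : ℕ, n = x ^ 2 + y ^ 2 + z ^ 2 + w ^ 2 ∧
        IsSquare ((x : ℤ) ^ 2 - (y : ℤ) ^ 2) ∧ Even ((x : ℤ) ^ 2 - (y : ℤ) ^ 2)) ∧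
      Suitable (2 * (polyX ^ 2 - polyY ^ 2)) ∧
      Suitable (3 * (polyX ^ 2 - polyY ^ 2)) ∧
      Suitable (polyX ^ 2 - 3 * polyY ^ 2) ∧
      Suitable (3 * polyX ^ 2 - 2 * polyY ^ 2)) ∧
    (Suitable (polyX ^ 2 + 2 * polyY ^ 2) ∧
      Suitable (polyX ^ 2 + 3 * polyY ^ 2) ∧
      Suitable (polyX ^ 2 + 5 * polyY ^ 2) ∧
      Suitable (polyX ^ 2 + 6 * polyY ^ 2) ∧
      Suitable (polyX ^ 2 + 8 * polyY ^ 2) ∧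
      Suitable (polyX ^ 2 + 12 * polyY ^ 2) ∧
      Suitable (2 * polyX ^ 2 + 7 * polyY ^ 2) ∧
      Suitable (3 * polyX ^ 2 + 4 * polyY ^ 2) ∧
      Suitable (4 * polyX ^ 2 + 5 * polyY ^ 2) ∧
      Suitable (4 * polyX ^ 2 + 9 * polyY ^ 2) ∧
      Suitable (5 * polyX ^ 2 + 11 * polyY ^ 2) ∧
      Suitable (6 * polyX ^ 2 + 10 * polyY ^ 2) ∧
      Suitable (7 * polyX ^ 2 + 9 * polyY ^ 2)) := by
  refine ⟨⟨exists_sq_sub_sq_even_square, ?_, ?_, ?_, ?_⟩,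
    ?_, ?_, ?_, ?_, ?_, ?_, ?_, ?_, ?_, ?_, ?_, ?_, ?_⟩
  · exact suitable_of_repBy (A := 2) (B := -2) (fun f => by simp; ring)
      1 1 3 1 ⟨0, by norm_num⟩ ⟨4, by norm_num⟩ repBy_two_or_ten
  · exact suitable_of_repBy (A := 3) (B := -3) (fun f => by simp; ring)
      1 1 2 1 ⟨0, by norm_num⟩ ⟨3, by norm_num⟩ repBy_two_or_five
  · exact suitable_of_repBy (A := 1) (B := -3) (fun f => by simp [sub_eq_add_neg])
      1 0 2 1 ⟨1, by norm_num⟩ ⟨1, by norm_num⟩ repBy_one_or_five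
  · exact suitable_of_repBy (A := 3) (B := -2) (fun f => by simp [sub_eq_add_neg])
      1 1 3 1 ⟨1, by norm_num⟩ ⟨5, by norm_num⟩ repBy_two_or_ten
  · exact suitable_of_repBy (A := 1) (B := 2) (fun f => by simp)
      1 0 1 2 ⟨1, by norm_num⟩ ⟨3, by norm_num⟩ repBy_one_or_five
  · exact suitable_of_repBy (A := 1) (B := 3) (fun f => by simp)
      1 0 1 1 ⟨1, by norm_num⟩ ⟨2, by norm_num⟩ repBy_one_or_two
  · exact suitable_of_repBy (A := 1) (B := 5) (fun f => by simp)
      1 0 2 1 ⟨1, by norm_num⟩ ⟨3, by norm_num⟩ repBy_one_or_five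
  · exact suitable_of_repBy (A := 1) (B := 6) (fun f => by simp)
      1 0 1 2 ⟨1, by norm_num⟩ ⟨5, by norm_num⟩ repBy_one_or_five
  · exact suitable_of_repBy (A := 1) (B := 8) (fun f => by simp)
      1 0 1 1 ⟨1, by norm_num⟩ ⟨3, by norm_num⟩ repBy_one_or_two
  · exact suitable_of_repBy (A := 1) (B := 12) (fun f => by simp)
      1 0 1 2 ⟨1, by norm_num⟩ ⟨7, by norm_num⟩ repBy_one_or_five
  · exact suitable_of_repBy (A := 2) (B := 7) (fun f => by simp)
      1 1 3 1 ⟨3, by norm_num⟩ ⟨5, by norm_num⟩ repBy_two_or_ten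
  · exact suitable_of_repBy (A := 3) (B := 4) (fun f => by simp)
      0 1 2 1 ⟨2, by norm_num⟩ ⟨4, by norm_num⟩ repBy_one_or_five
  · exact suitable_of_repBy (A := 4) (B := 5) (fun f => by simp)
      1 0 1 1 ⟨2, by norm_num⟩ ⟨3, by norm_num⟩ repBy_one_or_two
  · exact suitable_of_repBy (A := 4) (B := 9) (fun f => by simp)
      1 0 2 1 ⟨2, by norm_num⟩ ⟨5, by norm_num⟩ repBy_one_or_five
  · exact suitable_of_repBy (A := 5) (B := 11) (fun f => by simp)
      1 1 1 2 ⟨4, by norm_num⟩ ⟨7, by norm_num⟩ repBy_two_or_five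
  · exact suitable_of_repBy (A := 6) (B := 10) (fun f => by simp)
      1 1 3 1 ⟨4, by norm_num⟩ ⟨8, by norm_num⟩ repBy_two_or_ten
  · exact suitable_of_repBy (A := 7) (B := 9) (fun f => by simp)
      0 1 1 1 ⟨3, by norm_num⟩ ⟨4, by norm_num⟩ repBy_one_or_two
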